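/- Let $\delta_a,\delta_b,\delta_c$ be binary matrices of sizes $r_a\times n_a$, $r_b\times n_b$, $r_c\times n_c$. For $\ell\in\{a,b,c\}$ let $d_\ell$ be the minimum Hamming weight of a nonzero vector of $\ker\delta_\ell$ over $\mathbb{F}_2$ ($d_\ell=\infty$ if $\ker\delta_\ell=0$), and assume $d_\ell\ge 2$. The 3D hypergraph product code of $\delta_a,\delta_b,\delta_c$ is the CSS code with $H_Z=\partial_0^T$ and $H_X=\partial_1$, where $$\partial_0=\begin{pmatrix}\delta_a\otimes I_{n_b}\otimes I_{n_c}\\ I_{n_a}\otimes\delta_b\otimes I_{n_c}\\ I_{n_a}\otimes I_{n_b}\otimes\delta_c\end{pmatrix},\qquad \partial_1=\begin{pmatrix} I_{r_a}\otimes\delta_b\otimes I_{n_c} & \delta_a\otimes I_{r_b}\otimes I_{n_c} & 0\\ I_{r_a}\otimes I_{n_b}\otimes\delta_c & 0 & \delta_a\otimes I_{n_b}\otimes I_{r_c}\\ 0 & I_{n_a}\otimes I_{r_b}\otimes\delta_c & I_{n_a}\otimes\delta_b\otimes I_{r_c}\end{pmatrix}.$$ Its stabilizer generators are the rows of $H_X$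 ($X$-type) and of $H_Z$ ($Z$-type). Let $w_c$ be the maximum weight of a stabilizer generator, and $w_q$ the maximum number of stabilizer generators acting nontrivially on a single qubit. The energy $\epsilon(P)$ of a Pauli operator $P$ is the number of stabilizer generators that anticommute with $P$, and its energy barrier is $$\Delta(P)=\min_{(P_0,\dots,P_t)}\ \max_{0\le i\le t}\epsilon(P_i),$$ the minimum being over all finite sequences of Pauli operators with $P_0=I$ and $P_t=P$ in which consecutive operators differ on at most one qubit. If $d_a,d_b,d_c\ge w_c w_q$, then every $Z$-type logical operator $L$ (that is, every $Z$-type Pauli operator whose binary vector lies in $\ker H_X\setminus\operatorname{im}H_Z^T$) satisfies $$\Delta(L)\ \ge\ \min(d_a,d_b,d_c).$$ -/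

import Mathlib

open scoped Kronecker Matrix

namespace HGP

/-- The minimum distance of the binary linear code with parity-check matrix `H`: the least Hamming
weight of a nonzero codeword (`⊤` if the only codeword is `0`). -/
noncomputable def distance {m n : Type*} [Fintype n] (H : Matrix m n (ZMod 2)) : ℕ∞ :=
  ⨅ (v : n → ZMod 2) (_ : H *ᵥ v = 0) (_ : v ≠ 0), (hammingNorm v : ℕ∞)

/-- A Pauli operator on the qubits `Q`, up to phase, in binary representation: on qubit `q` it acts
as `X ^ (x q) * Z ^ (z q)`. -/
@[ext]
structure Pauli (Q : Type*) where
  x : Q → ZMod 2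
  z : Q → ZMod 2

namespace Pauli

/-- The identity operator. -/
def id (Q : Type*) : Pauli Q := ⟨0, 0⟩

/-- A Pauli operator is of `Z`-type if it is a product of single-qubit `Z` operators. -/
def IsZType {Q : Type*} (P : Pauli Q) : Prop := P.x = 0

/-- The number of qubits on which two Pauli operators differ. -/
def differ {Q : Type*} [Fintype Q] (P P' : Pauli Q) : ℕ :=
  hammingDist (fun q => (P.x q, P.z q)) (fun q => (P'.x q, P'.z q))

/-- `p 0, …, p t` is a path from `P` to `P'`: consecutive operators differ on at most one qubit. -/
structure IsPath {Q : Type*} [Fintype Q] {t : ℕ} (p : Fin (t + 1) → Pauli Q) (P P' : Pauli Q) :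
    Prop where
  start : p 0 = P
  finish : p (Fin.last t) = P'
  step : ∀ i : Fin t, differ (p i.castSucc) (p i.succ) ≤ 1

end Pauli

/-- A CSS code on the qubits `Q`. The rows of `HX` are the `X`-type stabilizer generators, the
rows of `HZ` are the `Z`-type stabilizer generators, and all generators commute. -/
structure CSSCode (MX MZ Q : Type*) [Fintype Q] where
  HX : Matrix MX Q (ZMod 2)
  HZ : Matrix MZ Q (ZMod 2)
  comm : HX * HZᵀ = 0

namespace CSSCode

variable {MX MZ Q : Type*} [Fintype MX] [Fintype MZ] [Fintype Q]

/-- The energy of a Pauli operator: the number of stabilizer generators that anticommute with it.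
An `X`-type generator anticommutes with `P` iff it overlaps the `Z`-part of `P` oddly, and a
`Z`-type generator iff it overlaps the `X`-part of `P` oddly. -/
def energy (C : CSSCode MX MZ Q) (P : Pauli Q) : ℕ :=
  hammingNorm (C.HX *ᵥ P.z) + hammingNorm (C.HZ *ᵥ P.x)

/-- The energy barrier of `P`: the minimum, over all paths from the identity to `P`, of the maximal
energy along the path. -/
noncomputable def energyBarrier (C : CSSCode MX MZ Q) (P : Pauli Q) : ℕ∞ :=
  ⨅ (t : ℕ) (p : Fin (t + 1) → Pauli Q) (_ : Pauli.IsPath p (Pauli.id Q) P),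
    ⨆ i, (C.energy (p i) : ℕ∞)

/-- `P` is, up to phase, a product of stabilizer generators. -/
def IsStabilizer (C : CSSCode MX MZ Q) (P : Pauli Q) : Prop :=
  (∃ u : MX → ZMod 2, P.x = C.HXᵀ *ᵥ u) ∧ (∃ u : MZ → ZMod 2, P.z = C.HZᵀ *ᵥ u)

/-- `P` is a (nontrivial) logical operator: it commutes with all stabilizer generators but is not a
stabilizer. -/
def IsLogical (C : CSSCode MX MZ Q) (P : Pauli Q) : Prop :=
  C.HX *ᵥ P.z = 0 ∧ C.HZ *ᵥ P.x = 0 ∧ ¬ C.IsStabilizer P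

/-- The sparsity parameter `w_c`: the maximum weight of a stabilizer generator. -/
def wc (C : CSSCode MX MZ Q) : ℕ :=
  max (Finset.univ.sup fun i => hammingNorm (C.HX i))
    (Finset.univ.sup fun j => hammingNorm (C.HZ j))

/-- The sparsity parameter `w_q`: the maximum number of stabilizer generators (of both types)
that act nontrivially on a single qubit. -/
def wq (C : CSSCode MX MZ Q) : ℕ :=
  Finset.univ.sup fun q => hammingNorm (fun i => C.HX i q) + hammingNorm (fun j => C.HZ j q)

end CSSCode

section Product

variable {Ra Na Rb Nb Rc Nc : Type*}
  [DecidableEq Ra] [DecidableEq Na] [DecidableEq Rb] [DecidableEq Nb]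
  [DecidableEq Rc] [DecidableEq Nc]

/-- The qubits of the 3D hypergraph product, for bits `N` and checks `R` of the three codes. -/
abbrev Qubits (Ra Na Rb Nb Rc Nc : Type*) : Type _ :=
  (Ra × Nb × Nc) ⊕ (Na × Rb × Nc) ⊕ (Na × Nb × Rc)

/-- The `X`-checks of the 3D hypergraph product. -/
abbrev XChecks (Ra Na Rb Nb Rc Nc : Type*) : Type _ :=
  (Ra × Rb × Nc) ⊕ (Ra × Nb × Rc) ⊕ (Na × Rb × Rc)

/-- The coboundary map `∂₀`, with row blocks `δa ⊗ I ⊗ I`, `I ⊗ δb ⊗ I`, `I ⊗ I ⊗ δc`. -/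
def boundary₀ (δa : Matrix Ra Na (ZMod 2)) (δb : Matrix Rb Nb (ZMod 2))
    (δc : Matrix Rc Nc (ZMod 2)) :
    Matrix (Qubits Ra Na Rb Nb Rc Nc) (Na × Nb × Nc) (ZMod 2) :=
  Matrix.fromRows (δa ⊗ₖ ((1 : Matrix Nb Nb (ZMod 2)) ⊗ₖ (1 : Matrix Nc Nc (ZMod 2))))
    (Matrix.fromRows ((1 : Matrix Na Na (ZMod 2)) ⊗ₖ (δb ⊗ₖ (1 : Matrix Nc Nc (ZMod 2))))
      ((1 : Matrix Na Na (ZMod 2)) ⊗ₖ ((1 : Matrix Nb Nb (ZMod 2)) ⊗ₖ δc)))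

/-- The coboundary map `∂₁`, the three-by-three block matrix
`(I ⊗ δb ⊗ I, δa ⊗ I ⊗ I, 0; I ⊗ I ⊗ δc, 0, δa ⊗ I ⊗ I; 0, I ⊗ I ⊗ δc, I ⊗ δb ⊗ I)`. -/
def boundary₁ (δa : Matrix Ra Na (ZMod 2)) (δb : Matrix Rb Nb (ZMod 2))
    (δc : Matrix Rc Nc (ZMod 2)) :
    Matrix (XChecks Ra Na Rb Nb Rc Nc) (Qubits Ra Na Rb Nb Rc Nc) (ZMod 2) :=
  Matrix.fromRows
    (Matrix.fromCols ((1 : Matrix Ra Ra (ZMod 2)) ⊗ₖ (δb ⊗ₖ (1 : Matrix Nc Nc (ZMod 2))))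
      (Matrix.fromCols (δa ⊗ₖ ((1 : Matrix Rb Rb (ZMod 2)) ⊗ₖ (1 : Matrix Nc Nc (ZMod 2)))) 0))
    (Matrix.fromRows
      (Matrix.fromCols ((1 : Matrix Ra Ra (ZMod 2)) ⊗ₖ ((1 : Matrix Nb Nb (ZMod 2)) ⊗ₖ δc))
        (Matrix.fromCols 0 (δa ⊗ₖ ((1 : Matrix Nb Nb (ZMod 2)) ⊗ₖ (1 : Matrix Rc Rc (ZMod 2))))))
      (Matrix.fromCols 0
        (Matrix.fromCols ((1 : Matrix Na Na (ZMod 2)) ⊗ₖ ((1 : Matrix Rb Rb (ZMod 2)) ⊗ₖ δc))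
          ((1 : Matrix Na Na (ZMod 2)) ⊗ₖ (δb ⊗ₖ (1 : Matrix Rc Rc (ZMod 2)))))))

variable [Fintype Ra] [Fintype Na] [Fintype Rb] [Fintype Nb] [Fintype Rc] [Fintype Nc]

theorem boundary₁_mul_boundary₀ (δa : Matrix Ra Na (ZMod 2)) (δb : Matrix Rb Nb (ZMod 2))
    (δc : Matrix Rc Nc (ZMod 2)) : boundary₁ δa δb δc * boundary₀ δa δb δc = 0 := by
  simp only [boundary₁, boundary₀, Matrix.fromRows_mul, Matrix.fromCols_mul_fromRows,
    ← Matrix.mul_kronecker_mul, Matrix.one_mul, Matrix.mul_one, Matrix.zero_mul, add_zero, zero_add]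
  ext i j
  rcases i with i | i | i <;> exact CharTwo.add_self_eq_zero _

/-- The 3D hypergraph product code of `δa`, `δb`, `δc`: the CSS code with `H_X = ∂₁` and
`H_Z = ∂₀ᵀ`. -/
def code3D (δa : Matrix Ra Na (ZMod 2)) (δb : Matrix Rb Nb (ZMod 2))
    (δc : Matrix Rc Nc (ZMod 2)) :
    CSSCode (XChecks Ra Na Rb Nb Rc Nc) (Na × Nb × Nc) (Qubits Ra Na Rb Nb Rc Nc) where
  HX := boundary₁ δa δb δc
  HZ := (boundary₀ δa δb δc)ᵀ
  comm := by rw [Matrix.transpose_transpose]; exact boundary₁_mul_boundary₀ δa δb δc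

end Product

end HGP

/-! ### Weights and generalized inverses over 𝔽₂. -/

namespace HGP

/-! Suppose a path to `L` stays below energy `d`, the least of the three distances; then the
`Z`-part of `L` is a coboundary, so `L` is not logical. By a Künneth-type criterion
(`mem_range_boundary₀`), a cocycle is a coboundary once each of its three blocks, contracted along
its check direction with any `u` in the left kernel of that direction's matrix, vanishes.

Contraction turns a block into a matrix `M` indexed by the bits of the other two codes. In each
syndrome block involved, `u` kills the contribution of the other qubit block, so every violated row
or column of `M` costs at least one violated check (`contraction_last_eq_zero`).

Along the path `M` changes in at most one entry at a time, and every nonzero entry keeps lying in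
both a violated row and a violated column: an unviolated nonzero line would be a codeword of weight
below `d` (`last_eq_zero_of_violations_lt`). At the end nothing is violated, so `M = 0`. -/

theorem distance_le_hammingNorm {m n : Type*} [Fintype n] {H : Matrix m n (ZMod 2)}
    {v : n → ZMod 2} (h : H *ᵥ v = 0) (hv : v ≠ 0) : distance H ≤ (hammingNorm v : ℕ∞) :=
  iInf_le_of_le v (iInf_le_of_le h (iInf_le _ hv))

theorem hammingNorm_sum {α β : Type*} [Fintype α] [Fintype β] (s : α ⊕ β → ZMod 2) :
    hammingNorm s = hammingNorm (fun a => s (.inl a)) + hammingNorm (fun b => s (.inr b)) := by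
  classical
  simp only [hammingNorm, Finset.card_filter, Fintype.sum_sum_type]

theorem hammingNorm_le_of_fiber {α β γ : Type*} [Fintype α] [Fintype β] [DecidableEq γ] [Zero γ]
    (s : α → ZMod 2) (w : β → γ) (f : α → β)
    (h : ∀ b, w b ≠ 0 → ∃ a, f a = b ∧ s a ≠ 0) : hammingNorm w ≤ hammingNorm s := by
  classical
  refine (Finset.card_le_card (t := (Finset.univ.filter fun a => s a ≠ 0).image f) ?_).trans
    Finset.card_image_le
  intro b hb
  obtain ⟨a, rfl, ha⟩ := h b (Finset.mem_filter.1 hb).2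
  exact Finset.mem_image_of_mem f (by simpa using ha)

/-- Compose a projection onto the image of `A` with a linear section of `A` over that image. -/
theorem exists_generalized_inverse {m n : ℕ} (A : Matrix (Fin m) (Fin n) (ZMod 2)) :
    ∃ G : Matrix (Fin n) (Fin m) (ZMod 2), A * G * A = A := by
  let f := Matrix.toLin' A
  obtain ⟨s, hs⟩ := f.rangeRestrict.exists_rightInverse_of_surjective f.range_rangeRestrict
  obtain ⟨p, hp⟩ := (LinearMap.range f).subtype.exists_leftInverse_of_injective
    (LinearMap.range f).ker_subtype
  refine ⟨LinearMap.toMatrix' (s ∘ₗ p), ?_⟩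
  apply Matrix.toLin'.injective
  rw [Matrix.toLin'_mul, Matrix.toLin'_mul, Matrix.toLin'_toMatrix']
  have h1 : ∀ v, p (f v) = f.rangeRestrict v := fun v => LinearMap.congr_fun hp (f.rangeRestrict v)
  have h2 : ∀ v, f (s (f.rangeRestrict v)) = f v := fun v =>
    congrArg Subtype.val (LinearMap.congr_fun hs (f.rangeRestrict v))
  refine LinearMap.ext fun v => ?_
  change f (s (p (f v))) = f v
  rw [h1, h2]

/-- If all vectors orthogonal to the columns of `A` are orthogonal to `x`, then a generalized
inverse of `A` solves `A w = x`. -/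
theorem mulVec_generalized_inverse {m n : ℕ} {A : Matrix (Fin m) (Fin n) (ZMod 2)}
    {G : Matrix (Fin n) (Fin m) (ZMod 2)} (hG : A * G * A = A) {x : Fin m → ZMod 2}
    (hx : ∀ u, u ᵥ* A = 0 → u ⬝ᵥ x = 0) : A *ᵥ (G *ᵥ x) = x := by
  -- Each row of `1 - A * G` annihilates `A` from the left, so `hx` applies to it.
  have key : (1 - A * G) *ᵥ x = 0 := by
    ext r
    refine hx _ ?_
    have : (1 - A * G) * A = 0 := by rw [Matrix.sub_mul, hG, Matrix.one_mul, sub_self]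
    exact congrFun this r
  rw [Matrix.sub_mulVec, Matrix.one_mulVec, sub_eq_zero] at key
  rw [Matrix.mulVec_mulVec, ← key]

/-! ### Violated rows and columns along a path of matrices. -/

theorem card_le_card_add_one {α : Type*} [DecidableEq α] {F W : Finset α}
    (h : ∀ x ∈ F, ∀ y ∈ F, x ∉ W → y ∉ W → x = y) : F.card ≤ W.card + 1 := by
  have h1 : (F \ W).card ≤ 1 := Finset.card_le_one.2 fun x hx y hy => by
    rw [Finset.mem_sdiff] at hx hy
    exact h x hx.1 y hy.1 hx.2 hy.2
  have := Finset.card_le_card_sdiff_add_card (s := F) (t := W)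
  omega

/-- A path of matrices, changing one entry at a time, that starts at `0` and always has fewer than
`d` violated columns and rows, ends at `0` if it ends in the product code. -/
theorem last_eq_zero_of_violations_lt {J K S T : Type*} [Fintype J] [Fintype K] [Fintype S]
    [Fintype T] (B : Matrix S J (ZMod 2)) (C : Matrix T K (ZMod 2)) {d : ℕ∞} (hd : 2 ≤ d)
    (hB : d ≤ distance B) (hC : d ≤ distance C) {t : ℕ} (M : Fin (t + 1) → J → K → ZMod 2)
    (h0 : M 0 = 0)
    (hstep : ∀ i : Fin t, ∀ p q : J × K, M i.castSucc p.1 p.2 ≠ M i.succ p.1 p.2 →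
      M i.castSucc q.1 q.2 ≠ M i.succ q.1 q.2 → p = q)
    (henergy : ∀ i, ((hammingNorm (fun k => B *ᵥ fun j => M i j k) +
      hammingNorm (fun j => C *ᵥ M i j) : ℕ) : ℕ∞) < d)
    (hlast : ∀ j, C *ᵥ M (Fin.last t) j = 0) : M (Fin.last t) = 0 := by
  classical
  have key : ∀ i, ∀ j k, M i j k ≠ 0 → (B *ᵥ fun j => M i j k) ≠ 0 ∧ C *ᵥ M i j ≠ 0 := by
    intro i
    induction i using Fin.induction with
    | zero => intro j k h; simp [h0] at h
    | succ i ih =>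
      have he := henergy i.castSucc
      set U := Finset.univ.filter fun k => (B *ᵥ fun j => M i.castSucc j k) ≠ 0 with hU
      set V := Finset.univ.filter fun j => C *ᵥ M i.castSucc j ≠ 0 with hV
      have he' : ((U.card + V.card : ℕ) : ℕ∞) < d := he
      -- Here `a` is the weight of a line of the new matrix, `b` counts old violated lines crossing
      -- it and `c` those parallel to it. If `c > 0`, it absorbs the `+ 1` from the changed entry;
      -- if `c = 0`, the old matrix was zero and `2 ≤ d` suffices.
      have bound : ∀ a b c : ℕ, (a ≤ b + 1) → (c = 0 → a ≤ 1) → b + c = U.card + V.card →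
          ((a : ℕ) : ℕ∞) < d := by
        intro a b c h1 h2 h3
        rcases Nat.eq_zero_or_pos c with hc | hc
        · refine lt_of_lt_of_le ?_ hd
          exact_mod_cast Nat.lt_succ_of_le (h2 hc)
        · refine lt_of_le_of_lt ?_ he'
          exact_mod_cast (by omega : a ≤ U.card + V.card)
      have memU : ∀ j k, M i.castSucc j k ≠ 0 → k ∈ U := fun j k h => by
        simpa [hU] using (ih j k h).1
      have memV : ∀ j k, M i.castSucc j k ≠ 0 → j ∈ V := fun j k h => by
        simpa [hV] using (ih j k h).2
      have hne : ∀ j k, M i.succ j k ≠ 0 → ¬ M i.castSucc j k ≠ 0 →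
          M i.castSucc j k ≠ M i.succ j k := fun j k h h' => by
        rw [not_not.1 h']; exact h.symm
      intro j k hjk
      constructor
      -- Column `k` would be a nonzero codeword, supported on the old violated rows and at most the
      -- one changed entry.
      · intro hk
        refine absurd (distance_le_hammingNorm hk fun h => hjk (congrFun h j))
          (not_le.2 (lt_of_lt_of_le (bound _ V.card U.card ?_ ?_ (add_comm _ _)) hB))
        · refine card_le_card_add_one fun x hx y hy hx' hy' => ?_
          rw [Finset.mem_filter] at hx hy
          exact congrArg Prod.fst (hstep i (x, k) (y, k) (hne x k hx.2 fun h => hx' (memV _ _ h))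
            (hne y k hy.2 fun h => hy' (memV _ _ h)))
        · intro h
          rw [Finset.card_eq_zero] at h
          refine Finset.card_le_one.2 fun x hx y hy => ?_
          rw [Finset.mem_filter] at hx hy
          exact congrArg Prod.fst (hstep i (x, k) (y, k)
            (hne x k hx.2 fun h' => by simpa [h] using memU _ _ h')
            (hne y k hy.2 fun h' => by simpa [h] using memU _ _ h'))
      · intro hj
        refine absurd (distance_le_hammingNorm hj fun h => hjk (congrFun h k))
          (not_le.2 (lt_of_lt_of_le (bound _ U.card V.card ?_ ?_ rfl) hC))
        · refine card_le_card_add_one fun x hx y hy hx' hy' => ?_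
          rw [Finset.mem_filter] at hx hy
          exact congrArg Prod.snd (hstep i (j, x) (j, y) (hne j x hx.2 fun h => hx' (memU _ _ h))
            (hne j y hy.2 fun h => hy' (memU _ _ h)))
        · intro h
          rw [Finset.card_eq_zero] at h
          refine Finset.card_le_one.2 fun x hx y hy => ?_
          rw [Finset.mem_filter] at hx hy
          exact congrArg Prod.snd (hstep i (j, x) (j, y)
            (hne j x hx.2 fun h' => by simpa [h] using memV _ _ h')
            (hne j y hy.2 fun h' => by simpa [h] using memV _ _ h'))
  ext j k
  by_contra h
  exact (key _ j k h).2 (hlast j)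

/-! ### Contraction of syndromes. -/

/-- Contracting a block `I ⊗ D + A ⊗ I` with a vector in the left kernel of `A`. -/
theorem contract_block {R N J : Type*} [Fintype R] [Fintype N] [Fintype J]
    {A : Matrix R N (ZMod 2)} {u : R → ZMod 2} (hu : u ᵥ* A = 0) (D : J → ZMod 2)
    (f : R → J → ZMod 2) (g : N → ZMod 2) :
    ∑ r, u r * (D ⬝ᵥ f r + A r ⬝ᵥ g) = D ⬝ᵥ fun j => u ⬝ᵥ fun r => f r j := by
  have h : ∑ r, u r * (A r ⬝ᵥ g) = 0 := by
    change u ⬝ᵥ (A *ᵥ g) = 0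
    rw [Matrix.dotProduct_mulVec, hu, zero_dotProduct]
  simp only [mul_add, Finset.sum_add_distrib, h, add_zero]
  simp only [dotProduct, Finset.mul_sum]
  rw [Finset.sum_comm]
  exact Finset.sum_congr rfl fun j _ => Finset.sum_congr rfl fun r _ => by ring

/-- A path in which the contractions of violated columns and rows come from the syndromes `s₁` and
`s₂` ends in a vector whose contraction with `u` vanishes. -/
theorem contraction_last_eq_zero {R J K S T : Type*} [Fintype R] [Fintype J] [Fintype K]
    [Fintype S] [Fintype T] (B : Matrix S J (ZMod 2)) (C : Matrix T K (ZMod 2)) {d : ℕ∞}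
    (hd : 2 ≤ d) (hB : d ≤ distance B) (hC : d ≤ distance C) (u : R → ZMod 2) {t : ℕ}
    (x : Fin (t + 1) → R → J → K → ZMod 2) (s₁ : Fin (t + 1) → R × S × K → ZMod 2)
    (s₂ : Fin (t + 1) → R × J × T → ZMod 2)
    (hs₁ : ∀ i s k, ∑ r, u r * s₁ i (r, s, k) = B s ⬝ᵥ fun j => u ⬝ᵥ fun r => x i r j k)
    (hs₂ : ∀ i j c, ∑ r, u r * s₂ i (r, j, c) = C c ⬝ᵥ fun k => u ⬝ᵥ fun r => x i r j k)
    (h0 : x 0 = 0)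
    (hstep : ∀ i : Fin t, ∀ p q : R × J × K,
      x i.castSucc p.1 p.2.1 p.2.2 ≠ x i.succ p.1 p.2.1 p.2.2 →
      x i.castSucc q.1 q.2.1 q.2.2 ≠ x i.succ q.1 q.2.1 q.2.2 → p = q)
    (henergy : ∀ i, ((hammingNorm (s₁ i) + hammingNorm (s₂ i) : ℕ) : ℕ∞) < d)
    (hlast : s₂ (Fin.last t) = 0) (j : J) (k : K) :
    u ⬝ᵥ (fun r => x (Fin.last t) r j k) = 0 := by
  refine congrFun (congrFun (last_eq_zero_of_violations_lt B C hd hB hC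
    (fun i j k => u ⬝ᵥ fun r => x i r j k) ?_ ?_ ?_ ?_) j) k
  · ext j k
    simp [h0, dotProduct]
  · have diff : ∀ (i : Fin t) (p : J × K),
        (u ⬝ᵥ fun r => x i.castSucc r p.1 p.2) ≠ (u ⬝ᵥ fun r => x i.succ r p.1 p.2) →
        ∃ r, x i.castSucc r p.1 p.2 ≠ x i.succ r p.1 p.2 := fun i p h => by
      by_contra! h'
      exact h (congrArg _ (funext h'))
    intro i p q hp hq
    obtain ⟨r, hr⟩ := diff i p hp
    obtain ⟨r', hr'⟩ := diff i q hq
    exact congrArg Prod.snd (hstep i (r, p) (r', q) hr hr')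
  · intro i
    refine lt_of_le_of_lt ?_ (henergy i)
    refine Nat.cast_le.2 (add_le_add ?_ ?_)
    -- A violated column has a nonzero contracted check, hence some nonzero term of the sum over
    -- `r`.
    · refine hammingNorm_le_of_fiber _ _ (fun a => a.2.2) fun k hk => ?_
      obtain ⟨s, hs⟩ := Function.ne_iff.1 hk
      obtain ⟨r, -, hr⟩ := Finset.exists_ne_zero_of_sum_ne_zero
        ((hs₁ i s k).trans_ne hs)
      exact ⟨(r, s, k), rfl, right_ne_zero_of_mul hr⟩
    · refine hammingNorm_le_of_fiber _ _ (fun a => a.2.1) fun j hj => ?_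
      obtain ⟨c, hc⟩ := Function.ne_iff.1 hj
      obtain ⟨r, -, hr⟩ := Finset.exists_ne_zero_of_sum_ne_zero
        ((hs₂ i j c).trans_ne hc)
      exact ⟨(r, j, c), rfl, right_ne_zero_of_mul hr⟩
  · intro j
    ext c
    exact (hs₂ _ j c).symm.trans (by simp [hlast])

/-! ### Block formulas and the criterion for coboundaries. -/

section Blocks

variable {ra na rb nb rc nc : ℕ} (δa : Matrix (Fin ra) (Fin na) (ZMod 2))
  (δb : Matrix (Fin rb) (Fin nb) (ZMod 2)) (δc : Matrix (Fin rc) (Fin nc) (ZMod 2))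

theorem boundary₀_mulVec_a (w : Fin na × Fin nb × Fin nc → ZMod 2)
    (a : Fin ra) (j : Fin nb) (k : Fin nc) :
    (boundary₀ δa δb δc *ᵥ w) (.inl (a, j, k)) = δa a ⬝ᵥ fun i => w (i, j, k) := by
  simp [boundary₀, Matrix.mulVec, dotProduct, Fintype.sum_prod_type, Matrix.one_apply]

theorem boundary₀_mulVec_b (w : Fin na × Fin nb × Fin nc → ZMod 2)
    (i : Fin na) (b : Fin rb) (k : Fin nc) :
    (boundary₀ δa δb δc *ᵥ w) (.inr (.inl (i, b, k))) = δb b ⬝ᵥ fun j => w (i, j, k) := by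
  simp [boundary₀, Matrix.mulVec, dotProduct, Fintype.sum_prod_type, Matrix.one_apply]

theorem boundary₀_mulVec_c (w : Fin na × Fin nb × Fin nc → ZMod 2)
    (i : Fin na) (j : Fin nb) (c : Fin rc) :
    (boundary₀ δa δb δc *ᵥ w) (.inr (.inr (i, j, c))) = δc c ⬝ᵥ fun k => w (i, j, k) := by
  simp [boundary₀, Matrix.mulVec, dotProduct, Fintype.sum_prod_type, Matrix.one_apply]

theorem boundary₁_mulVec_ab
    (v : Qubits (Fin ra) (Fin na) (Fin rb) (Fin nb) (Fin rc) (Fin nc) → ZMod 2)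
    (a : Fin ra) (b : Fin rb) (k : Fin nc) :
    (boundary₁ δa δb δc *ᵥ v) (.inl (a, b, k)) =
      (δb b ⬝ᵥ fun j => v (.inl (a, j, k))) + δa a ⬝ᵥ fun i => v (.inr (.inl (i, b, k))) := by
  simp [boundary₁, Matrix.mulVec, dotProduct, Fintype.sum_prod_type, Matrix.one_apply]

theorem boundary₁_mulVec_ac
    (v : Qubits (Fin ra) (Fin na) (Fin rb) (Fin nb) (Fin rc) (Fin nc) → ZMod 2)
    (a : Fin ra) (j : Fin nb) (c : Fin rc) :
    (boundary₁ δa δb δc *ᵥ v) (.inr (.inl (a, j, c))) =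
      (δc c ⬝ᵥ fun k => v (.inl (a, j, k))) + δa a ⬝ᵥ fun i => v (.inr (.inr (i, j, c))) := by
  simp [boundary₁, Matrix.mulVec, dotProduct, Fintype.sum_prod_type, Matrix.one_apply]

theorem boundary₁_mulVec_bc
    (v : Qubits (Fin ra) (Fin na) (Fin rb) (Fin nb) (Fin rc) (Fin nc) → ZMod 2)
    (i : Fin na) (b : Fin rb) (c : Fin rc) :
    (boundary₁ δa δb δc *ᵥ v) (.inr (.inr (i, b, c))) =
      (δc c ⬝ᵥ fun k => v (.inr (.inl (i, b, k)))) +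
        δb b ⬝ᵥ fun j => v (.inr (.inr (i, j, c))) := by
  simp [boundary₁, Matrix.mulVec, dotProduct, Fintype.sum_prod_type, Matrix.one_apply]

theorem dotProduct_dotProduct_comm {I J : Type*} [Fintype I] [Fintype J] (p : I → ZMod 2)
    (q : J → ZMod 2) (f : I → J → ZMod 2) :
    (p ⬝ᵥ fun i => q ⬝ᵥ f i) = q ⬝ᵥ fun j => p ⬝ᵥ fun i => f i j := by
  simp only [dotProduct, Finset.mul_sum]
  rw [Finset.sum_comm]
  exact Finset.sum_congr rfl fun j _ => Finset.sum_congr rfl fun r _ => by ring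

/-- The blocks are cleared one at a time by subtracting coboundaries built from generalized
inverses. Closedness makes each block not yet cleared a cocycle in the directions already cleared; a
generalized inverse in another direction commutes with those maps, so later corrections leave
cleared blocks at zero. -/
theorem mem_range_boundary₀
    {v : Qubits (Fin ra) (Fin na) (Fin rb) (Fin nb) (Fin rc) (Fin nc) → ZMod 2}
    (hv : boundary₁ δa δb δc *ᵥ v = 0)
    (ha : ∀ u, u ᵥ* δa = 0 → ∀ j k, (u ⬝ᵥ fun a => v (.inl (a, j, k))) = 0)
    (hb : ∀ u, u ᵥ* δb = 0 → ∀ i k, (u ⬝ᵥ fun b => v (.inr (.inl (i, b, k)))) = 0)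
    (hc : ∀ u, u ᵥ* δc = 0 → ∀ i j, (u ⬝ᵥ fun c => v (.inr (.inr (i, j, c)))) = 0) :
    ∃ w, v = boundary₀ δa δb δc *ᵥ w := by
  obtain ⟨Ga, hGa⟩ := exists_generalized_inverse δa
  obtain ⟨Gb, hGb⟩ := exists_generalized_inverse δb
  obtain ⟨Gc, hGc⟩ := exists_generalized_inverse δc
  have closed : ∀ {v w}, boundary₁ δa δb δc *ᵥ v = 0 →
      boundary₁ δa δb δc *ᵥ (v - boundary₀ δa δb δc *ᵥ w) = 0 := fun {v w} h => by
    rw [Matrix.mulVec_sub, h, Matrix.mulVec_mulVec, boundary₁_mul_boundary₀, Matrix.zero_mulVec,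
      sub_zero]
  -- Subtracting a coboundary does not affect these contractions, so `hb` and `hc` carry over to
  -- `v₁` and `v₂`.
  have sub_im : ∀ {m n : ℕ} {A : Matrix (Fin m) (Fin n) (ZMod 2)} {u : Fin m → ZMod 2}
      {x : Fin m → ZMod 2} (y : Fin n → ZMod 2), u ᵥ* A = 0 → u ⬝ᵥ x = 0 →
      u ⬝ᵥ (fun r => x r - A r ⬝ᵥ y) = 0 := fun {m n A u x} y h h' => by
    change u ⬝ᵥ (x - A *ᵥ y) = 0
    rw [dotProduct_sub, h', Matrix.dotProduct_mulVec, h, zero_dotProduct, sub_zero]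
  set w₀ : Fin na × Fin nb × Fin nc → ZMod 2 := fun p =>
    Ga p.1 ⬝ᵥ fun a => v (.inl (a, p.2.1, p.2.2)) with hw₀
  set v₁ := v - boundary₀ δa δb δc *ᵥ w₀ with hv₁
  have hv₁a : ∀ a j k, v₁ (.inl (a, j, k)) = 0 := fun a j k => by
    rw [hv₁, Pi.sub_apply, boundary₀_mulVec_a, sub_eq_zero]
    exact (congrFun (mulVec_generalized_inverse hGa fun u hu => ha u hu j k) a).symm
  have hc₁ : boundary₁ δa δb δc *ᵥ v₁ = 0 := closed hv
  have hv₁ab : ∀ a b k, (δa a ⬝ᵥ fun i => v₁ (.inr (.inl (i, b, k)))) = 0 := fun a b k => by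
    have := congrFun hc₁ (.inl (a, b, k))
    simpa [boundary₁_mulVec_ab, hv₁a, dotProduct] using this
  set w₁ : Fin na × Fin nb × Fin nc → ZMod 2 := fun p =>
    Gb p.2.1 ⬝ᵥ fun b => v₁ (.inr (.inl (p.1, b, p.2.2))) with hw₁
  set v₂ := v₁ - boundary₀ δa δb δc *ᵥ w₁ with hv₂
  have hv₂a : ∀ a j k, v₂ (.inl (a, j, k)) = 0 := fun a j k => by
    rw [hv₂, Pi.sub_apply, boundary₀_mulVec_a, hv₁a, zero_sub, neg_eq_zero, hw₁]
    simp only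
    rw [dotProduct_dotProduct_comm]
    simp only [hv₁ab]
    exact dotProduct_zero _
  have hv₂b : ∀ i b k, v₂ (.inr (.inl (i, b, k))) = 0 := fun i b k => by
    rw [hv₂, Pi.sub_apply, boundary₀_mulVec_b, sub_eq_zero]
    suffices hx : ∀ u, u ᵥ* δb = 0 → (u ⬝ᵥ fun b => v₁ (.inr (.inl (i, b, k)))) = 0 from
      (congrFun (mulVec_generalized_inverse hGb hx) b).symm
    intro u hu
    simp only [hv₁, Pi.sub_apply, boundary₀_mulVec_b]
    exact sub_im _ hu (hb u hu i k)
  have hc₂ : boundary₁ δa δb δc *ᵥ v₂ = 0 := closed hc₁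
  have hv₂ac : ∀ a j c, (δa a ⬝ᵥ fun i => v₂ (.inr (.inr (i, j, c)))) = 0 := fun a j c => by
    have := congrFun hc₂ (.inr (.inl (a, j, c)))
    simpa [boundary₁_mulVec_ac, hv₂a, dotProduct] using this
  have hv₂bc : ∀ i b c, (δb b ⬝ᵥ fun j => v₂ (.inr (.inr (i, j, c)))) = 0 := fun i b c => by
    have := congrFun hc₂ (.inr (.inr (i, b, c)))
    simpa [boundary₁_mulVec_bc, hv₂b, dotProduct] using this
  set w₂ : Fin na × Fin nb × Fin nc → ZMod 2 := fun p =>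
    Gc p.2.2 ⬝ᵥ fun c => v₂ (.inr (.inr (p.1, p.2.1, c))) with hw₂
  have hv₃ : v₂ = boundary₀ δa δb δc *ᵥ w₂ := by
    ext q
    rcases q with ⟨a, j, k⟩ | ⟨i, b, k⟩ | ⟨i, j, c⟩
    · rw [boundary₀_mulVec_a, hv₂a, hw₂]
      simp only
      rw [dotProduct_dotProduct_comm]
      simp only [hv₂ac]
      exact (dotProduct_zero _).symm
    · rw [boundary₀_mulVec_b, hv₂b, hw₂]
      simp only
      rw [dotProduct_dotProduct_comm]
      simp only [hv₂bc]
      exact (dotProduct_zero _).symm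
    · rw [boundary₀_mulVec_c]
      suffices hx : ∀ u, u ᵥ* δc = 0 → (u ⬝ᵥ fun c => v₂ (.inr (.inr (i, j, c)))) = 0 from
        (congrFun (mulVec_generalized_inverse hGc hx) c).symm
      intro u hu
      simp only [hv₂, hv₁, Pi.sub_apply, boundary₀_mulVec_c]
      exact sub_im _ hu (sub_im _ hu (hc u hu i j))
  refine ⟨w₀ + w₁ + w₂, ?_⟩
  rw [Matrix.mulVec_add, Matrix.mulVec_add, ← hv₃, hv₂, hv₁]
  abel

theorem hammingNorm_boundary₁_mulVec
    (v : Qubits (Fin ra) (Fin na) (Fin rb) (Fin nb) (Fin rc) (Fin nc) → ZMod 2) :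
    hammingNorm (boundary₁ δa δb δc *ᵥ v) =
      hammingNorm (fun p => (boundary₁ δa δb δc *ᵥ v) (.inl p)) +
      (hammingNorm (fun p => (boundary₁ δa δb δc *ᵥ v) (.inr (.inl p))) +
      hammingNorm (fun p => (boundary₁ δa δb δc *ᵥ v) (.inr (.inr p)))) := by
  rw [hammingNorm_sum, hammingNorm_sum]

/-! ### From low-energy paths to coboundaries. -/

/-- A closed `Z`-type vector reached through vectors of small syndrome is a coboundary. -/
theorem mem_range_boundary₀_of_path {d : ℕ∞} (hd : 2 ≤ d) (hda : d ≤ distance δa)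
    (hdb : d ≤ distance δb) (hdc : d ≤ distance δc) {t : ℕ}
    (z : Fin (t + 1) → Qubits (Fin ra) (Fin na) (Fin rb) (Fin nb) (Fin rc) (Fin nc) → ZMod 2)
    (h0 : z 0 = 0)
    (hstep : ∀ i : Fin t, ∀ p q, z i.castSucc p ≠ z i.succ p → z i.castSucc q ≠ z i.succ q → p = q)
    (henergy : ∀ i, ((hammingNorm (boundary₁ δa δb δc *ᵥ z i) : ℕ) : ℕ∞) < d)
    (hlast : boundary₁ δa δb δc *ᵥ z (Fin.last t) = 0) :
    ∃ w, z (Fin.last t) = boundary₀ δa δb δc *ᵥ w := by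
  simp only [hammingNorm_boundary₁_mulVec] at henergy
  refine mem_range_boundary₀ δa δb δc hlast (fun u hu j k => ?_) (fun u hu i k => ?_)
    (fun u hu i j => ?_)
  · refine contraction_last_eq_zero δb δc hd hdb hdc u (fun n a j k => z n (.inl (a, j, k)))
      (fun n p => (boundary₁ δa δb δc *ᵥ z n) (.inl p))
      (fun n p => (boundary₁ δa δb δc *ᵥ z n) (.inr (.inl p)))
      (fun n b k => ?_) (fun n j c => ?_) ?_ (fun n p q hp hq => ?_) (fun n => ?_) ?_ j k
    · simp only [boundary₁_mulVec_ab]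
      exact contract_block hu (δb b) (fun a j => z n (.inl (a, j, k))) _
    · simp only [boundary₁_mulVec_ac]
      exact contract_block hu (δc c) (fun a k => z n (.inl (a, j, k))) _
    · simp only [h0]; rfl
    · exact Sum.inl_injective (hstep n (.inl p) (.inl q) hp hq)
    · exact lt_of_le_of_lt (Nat.cast_le.2 (by omega)) (henergy n)
    · simp only [hlast]; rfl
  · refine contraction_last_eq_zero δa δc hd hda hdc u
      (fun n b i k => z n (.inr (.inl (i, b, k))))
      (fun n p => (boundary₁ δa δb δc *ᵥ z n) (.inl (p.2.1, p.1, p.2.2)))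
      (fun n p => (boundary₁ δa δb δc *ᵥ z n) (.inr (.inr (p.2.1, p.1, p.2.2))))
      (fun n a k => ?_) (fun n i c => ?_) ?_ (fun n p q hp hq => ?_) (fun n => ?_) ?_ i k
    · simp only [boundary₁_mulVec_ab]
      simp only [add_comm (δb _ ⬝ᵥ _)]
      exact contract_block hu (δa a) (fun b i => z n (.inr (.inl (i, b, k)))) _
    · simp only [boundary₁_mulVec_bc]
      exact contract_block hu (δc c) (fun b k => z n (.inr (.inl (i, b, k)))) _
    · simp only [h0]; rfl
    · have := Sum.inl_injective (Sum.inr_injective (hstep n (.inr (.inl (p.2.1, p.1, p.2.2)))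
        (.inr (.inl (q.2.1, q.1, q.2.2))) hp hq))
      simp only [Prod.ext_iff] at this ⊢
      tauto
    · refine lt_of_le_of_lt (Nat.cast_le.2 ?_) (henergy n)
      -- Moving the contracted check index to the front only permutes coordinates, so weights do not
      -- grow.
      have h₁ := hammingNorm_le_of_fiber (fun p => (boundary₁ δa δb δc *ᵥ z n) (.inl p))
        (fun p : Fin rb × Fin ra × Fin nc =>
          (boundary₁ δa δb δc *ᵥ z n) (.inl (p.2.1, p.1, p.2.2)))
        (fun p => (p.2.1, p.1, p.2.2)) (fun p hp => ⟨(p.2.1, p.1, p.2.2), rfl, hp⟩)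
      have h₂ := hammingNorm_le_of_fiber (fun p => (boundary₁ δa δb δc *ᵥ z n) (.inr (.inr p)))
        (fun p : Fin rb × Fin na × Fin rc =>
          (boundary₁ δa δb δc *ᵥ z n) (.inr (.inr (p.2.1, p.1, p.2.2))))
        (fun p => (p.2.1, p.1, p.2.2)) (fun p hp => ⟨(p.2.1, p.1, p.2.2), rfl, hp⟩)
      omega
    · simp only [hlast]; rfl
  · refine contraction_last_eq_zero δa δb hd hda hdb u
      (fun n c i j => z n (.inr (.inr (i, j, c))))
      (fun n p => (boundary₁ δa δb δc *ᵥ z n) (.inr (.inl (p.2.1, p.2.2, p.1))))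
      (fun n p => (boundary₁ δa δb δc *ᵥ z n) (.inr (.inr (p.2.1, p.2.2, p.1))))
      (fun n a j => ?_) (fun n i b => ?_) ?_ (fun n p q hp hq => ?_) (fun n => ?_) ?_ i j
    · simp only [boundary₁_mulVec_ac]
      simp only [add_comm (δc _ ⬝ᵥ _)]
      exact contract_block hu (δa a) (fun c i => z n (.inr (.inr (i, j, c)))) _
    · simp only [boundary₁_mulVec_bc]
      simp only [add_comm (δc _ ⬝ᵥ _)]
      exact contract_block hu (δb b) (fun c j => z n (.inr (.inr (i, j, c)))) _
    · simp only [h0]; rfl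
    · have := Sum.inr_injective (Sum.inr_injective (hstep n (.inr (.inr (p.2.1, p.2.2, p.1)))
        (.inr (.inr (q.2.1, q.2.2, q.1))) hp hq))
      simp only [Prod.ext_iff] at this ⊢
      tauto
    · refine lt_of_le_of_lt (Nat.cast_le.2 ?_) (henergy n)
      have h₁ := hammingNorm_le_of_fiber (fun p => (boundary₁ δa δb δc *ᵥ z n) (.inr (.inl p)))
        (fun p : Fin rc × Fin ra × Fin nb =>
          (boundary₁ δa δb δc *ᵥ z n) (.inr (.inl (p.2.1, p.2.2, p.1))))
        (fun p => (p.2.2, p.1, p.2.1)) (fun p hp => ⟨(p.2.1, p.2.2, p.1), rfl, hp⟩)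
      have h₂ := hammingNorm_le_of_fiber (fun p => (boundary₁ δa δb δc *ᵥ z n) (.inr (.inr p)))
        (fun p : Fin rc × Fin na × Fin rb =>
          (boundary₁ δa δb δc *ᵥ z n) (.inr (.inr (p.2.1, p.2.2, p.1))))
        (fun p => (p.2.2, p.1, p.2.1)) (fun p hp => ⟨(p.2.1, p.2.2, p.1), rfl, hp⟩)
      omega
    · simp only [hlast]; rfl

end Blocks

/-- Operators that differ on at most one qubit have `Z`-parts that do. -/
theorem Pauli.eq_of_z_ne {Q : Type*} [Fintype Q] {P P' : Pauli Q} (h : differ P P' ≤ 1) {p q : Q}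
    (hp : P.z p ≠ P'.z p) (hq : P.z q ≠ P'.z q) : p = q := by
  classical
  refine Finset.card_le_one.1 h p ?_ q ?_
  · exact Finset.mem_filter.2 ⟨Finset.mem_univ _, fun h => hp (congrArg Prod.snd h)⟩
  · exact Finset.mem_filter.2 ⟨Finset.mem_univ _, fun h => hq (congrArg Prod.snd h)⟩

end HGP

theorem theorem1 {ra na rb nb rc nc : ℕ}
    (δa : Matrix (Fin ra) (Fin na) (ZMod 2))
    (δb : Matrix (Fin rb) (Fin nb) (ZMod 2))
    (δc : Matrix (Fin rc) (Fin nc) (ZMod 2))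
    (w_c w_q : ℕ)
    (hwc : (HGP.code3D δa δb δc).wc = w_c)
    (hwq : (HGP.code3D δa δb δc).wq = w_q)
    (hda : ((w_c * w_q : ℕ) : ℕ∞) ≤ HGP.distance δa)
    (hdb : ((w_c * w_q : ℕ) : ℕ∞) ≤ HGP.distance δb)
    (hdc : ((w_c * w_q : ℕ) : ℕ∞) ≤ HGP.distance δc)
    (hda2 : 2 ≤ HGP.distance δa)
    (hdb2 : 2 ≤ HGP.distance δb)
    (hdc2 : 2 ≤ HGP.distance δc)
    (L : HGP.Pauli (HGP.Qubits (Fin ra) (Fin na) (Fin rb) (Fin nb) (Fin rc) (Fin nc)))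
    (hL : (HGP.code3D δa δb δc).IsLogical L) (hLZ : L.IsZType) :
    min (HGP.distance δa) (min (HGP.distance δb) (HGP.distance δc)) ≤
      (HGP.code3D δa δb δc).energyBarrier L := by
  by_contra hlt
  rw [not_le] at hlt
  simp only [HGP.CSSCode.energyBarrier, iInf_lt_iff] at hlt
  obtain ⟨t, p, hp, hmax⟩ := hlt
  obtain ⟨hHX, -, hns⟩ := hL
  obtain ⟨w, hw⟩ := HGP.mem_range_boundary₀_of_path δa δb δc
    (le_min hda2 (le_min hdb2 hdc2)) (min_le_left _ _)
    ((min_le_right _ _).trans (min_le_left _ _)) ((min_le_right _ _).trans (min_le_right _ _))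
    (fun i => (p i).z) (by rw [hp.start]; rfl)
    (fun i _ _ h h' => HGP.Pauli.eq_of_z_ne (hp.step i) h h')
    -- The `X`-part of a path operator can only add to its energy, so it may be discarded.
    (fun i => lt_of_le_of_lt
      ((Nat.cast_le.2 (Nat.le_add_right _ _)).trans
        (le_iSup (fun i => ((HGP.code3D δa δb δc).energy (p i) : ℕ∞)) i)) hmax)
    (by rw [hp.finish]; exact hHX)
  rw [hp.finish] at hw
  exact hns ⟨⟨0, by rw [Matrix.mulVec_zero]; exact hLZ⟩, ⟨w, hw⟩⟩
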